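/- Let $M$ be a smooth Hausdorff manifold (without boundary) modelled on a real Banach space, with tangent bundle $\pi_M\colon TM\to M$, and suppose that $M$ is $C^\infty$-paracompact, i.e. $M$ is paracompact and every open cover of $M$ admits a subordinate smooth partition of unity. A \emph{local addition} on $M$ is a pair $(U,\Sigma)$ of an open neighbourhood $U\subseteq TM$ of the zero section and a map $\Sigma\colon U\to M$ such that $\Sigma(0_x)=x$ for all $x\in M$ and such that $(\pi_M,\Sigma)\colon U\to M\times M$ is a ($C^\infty$-)diffeomorphism onto an open subset of $M\times M$. A \emph{spray} on $M$ is a smooth vector field $S\colon TM\to TTM$ with $T\pi_M\circ S=\mathrm{id}_{TM}$ and $S\circ h_\lambda=Th_\lambda\circ(\lambda S)$ for all $\lambda\in\mathbb{R}$, where $h_\lambda\colon TM\to TM$ is multiplication by $\lambda$ in each fibre. Its \emph{exponential map} is $\exp_S(v)=\pi_M(\mathrm{Fl}^S_1(v))$, where $\mathrm{Fl}^S$ is the maximal flow of $S$; it is defined for all $v\in TM$ for which $\mathrm{Fl}^S_1(v)$ exists. Then $M$ admits a local addition. More precisely, $M$ admits a spray, and for every spray $S$ on $M$ there is an open neighbourhood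 $U\subseteq TM$ of the zero section, contained in the domain of $\exp_S$, such that $(U,\exp_S|_U)$ is a local addition on $M$. -/

import Mathlib

universe u

open Set
open scoped Manifold ContDiff Topology

/-- A manifold `M` is `C^∞`-paracompact if it is paracompact as a topological space and every open
cover of `M` admits a subordinate smooth partition of unity. -/
structure IsSmoothlyParacompact
    {E : Type*} [NormedAddCommGroup E] [NormedSpace ℝ E] {H : Type*} [TopologicalSpace H]
    (I : ModelWithCorners ℝ E H) (M : Type u) [TopologicalSpace M] [ChartedSpace H M] : Prop where
  paracompact : ParacompactSpace M
  exists_partition : ∀ (ι : Type u) (U : ι → Set M), (∀ i, IsOpen (U i)) → (⋃ i, U i) = univ →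
    ∃ f : SmoothPartitionOfUnity ι I M univ, f.IsSubordinate U

section Definitions

variable {E : Type*} [NormedAddCommGroup E] [NormedSpace ℝ E] {H : Type*} [TopologicalSpace H]
  (I : ModelWithCorners ℝ E H) {M : Type*} [TopologicalSpace M] [ChartedSpace H M]
  [IsManifold I ∞ M]

/-- A local addition on `M`: an open neighbourhood `U ⊆ TM` of the zero section and a map
`σ : U → M` (given as a map on `TM` whose values outside `U` are irrelevant) with `σ (0_x) = x` for
all `x`, such that `v ↦ (π v, σ v)` is a diffeomorphism of `U` onto an open subset of `M × M`. -/
structure IsLocalAddition (U : Set (TangentBundle I M)) (σ : TangentBundle I M → M) : Prop where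
  isOpen : IsOpen U
  zero_mem : ∀ x : M, (⟨x, 0⟩ : TangentBundle I M) ∈ U
  map_zero : ∀ x : M, σ ⟨x, 0⟩ = x
  diffeo : ∃ Φ : PartialDiffeomorph I.tangent (I.prod I) (TangentBundle I M) (M × M) ∞,
    Φ.source = U ∧ ∀ v ∈ U, Φ v = (v.proj, σ v)

/-- Multiplication by `c` in the fibres of `TM`. -/
noncomputable def fibreScale (c : ℝ) (v : TangentBundle I M) : TangentBundle I M :=
  ⟨v.proj, c • v.snd⟩

/-- A spray on `M`: a smooth vector field `S` on `TM` which satisfies `Tπ ∘ S = id` and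
`S ∘ h_c = T h_c ∘ (c S)` for all real `c`, where `h_c` is the multiplication by `c` in the
fibres of `TM`. -/
structure IsSpray (S : (v : TangentBundle I M) → TangentSpace I.tangent v) : Prop where
  smooth : ContMDiff I.tangent I.tangent.tangent ∞
    (fun v ↦ (⟨v, S v⟩ : TangentBundle I.tangent (TangentBundle I M)))
  lifts_id : ∀ v : TangentBundle I M,
    mfderiv I.tangent I (fun w : TangentBundle I M ↦ w.proj) v (S v) = v.snd
  homogeneous : ∀ (c : ℝ) (v : TangentBundle I M),
    S (fibreScale I c v) = mfderiv I.tangent I.tangent (fibreScale I c) v (c • S v)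

end Definitions

section Flow

variable {E : Type*} [NormedAddCommGroup E] [NormedSpace ℝ E] {H : Type*} [TopologicalSpace H]
  {I : ModelWithCorners ℝ E H} {N : Type*} [TopologicalSpace N] [ChartedSpace H N]

/-- `IsFlowCurve X v t γ`: on some open interval containing `0` and `t`, the curve `γ` is an integral
curve of the vector field `X` with `γ 0 = v`. -/
def IsFlowCurve (X : (x : N) → TangentSpace I x) (v : N) (t : ℝ) (γ : ℝ → N) : Prop :=
  γ 0 = v ∧ ∃ a b : ℝ, 0 ∈ Ioo a b ∧ t ∈ Ioo a b ∧ IsMIntegralCurveOn γ X (Ioo a b)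

/-- The maximal flow domain of the vector field `X`. -/
def flowDomain (X : (x : N) → TangentSpace I x) : Set (ℝ × N) :=
  {p | ∃ γ, IsFlowCurve X p.2 p.1 γ}

open Classical in
/-- The maximal flow of the vector field `X`, with the irrelevant value `v` outside of the flow
domain. For `C^1` vector fields on boundaryless Hausdorff manifolds, the value inside the flow
domain does not depend on the chosen integral curve, see `flow_eq`. -/
noncomputable def flow (X : (x : N) → TangentSpace I x) (t : ℝ) (v : N) : N :=
  if h : ∃ γ, IsFlowCurve X v t γ then h.choose t else v

theorem flow_eq [IsManifold I 1 N] [BoundarylessManifold I N] [T2Space N]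
    {X : (x : N) → TangentSpace I x}
    (hX : ContMDiff I I.tangent 1 (fun x ↦ (⟨x, X x⟩ : TangentBundle I N)))
    {v : N} {t : ℝ} {γ : ℝ → N} (hγ : IsFlowCurve X v t γ) : flow X t v = γ t := by
  have h : ∃ γ, IsFlowCurve X v t γ := ⟨γ, hγ⟩
  obtain ⟨h0, a, b, ha, ht, hi⟩ := h.choose_spec
  obtain ⟨h0', a', b', ha', ht', hi'⟩ := hγ
  rw [flow, dif_pos h]
  have hs : Ioo (max a a') (min b b') ⊆ Ioo a b :=
    Ioo_subset_Ioo (le_max_left _ _) (min_le_left _ _)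
  have hs' : Ioo (max a a') (min b b') ⊆ Ioo a' b' :=
    Ioo_subset_Ioo (le_max_right _ _) (min_le_right _ _)
  exact isMIntegralCurveOn_Ioo_eqOn_of_contMDiff_boundaryless (t₀ := 0)
    ⟨max_lt ha.1 ha'.1, lt_min ha.2 ha'.2⟩ hX (hi.mono hs) (hi'.mono hs') (h0.trans h0'.symm)
    ⟨max_lt ht.1 ht'.1, lt_min ht.2 ht'.2⟩

end Flow

section Exponential

variable {E : Type*} [NormedAddCommGroup E] [NormedSpace ℝ E] {H : Type*} [TopologicalSpace H]
  {I : ModelWithCorners ℝ E H} {M : Type*} [TopologicalSpace M] [ChartedSpace H M]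
  [IsManifold I ∞ M]

/-- The set of all `v ∈ TM` at which the flow of `S` is defined up to time `1`. -/
def sprayExpDomain (S : (v : TangentBundle I M) → TangentSpace I.tangent v) :
    Set (TangentBundle I M) :=
  {v | ((1 : ℝ), v) ∈ flowDomain S}

/-- The exponential map of the spray `S`: the base point of the time-one flow of `S`. It is
meaningful on `sprayExpDomain S`. -/
noncomputable def sprayExp (S : (v : TangentBundle I M) → TangentSpace I.tangent v)
    (v : TangentBundle I M) : M :=
  (flow S 1 v).proj

end Exponential

section Nemytskii

variable {K : Type*} [TopologicalSpace K]

open Classical in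
/-- The superposition operator `γ ↦ g ∘ γ` on spaces of continuous maps, with value `0` when
`g ∘ γ` is not continuous. -/
noncomputable def nemytskii {F G : Type*} [TopologicalSpace F] [TopologicalSpace G] [Zero G]
    (g : F → G) (γ : C(K, F)) : C(K, G) :=
  if h : Continuous (g ∘ γ) then ⟨g ∘ γ, h⟩ else 0

theorem nemytskii_apply {F G : Type*} [TopologicalSpace F] [TopologicalSpace G] [Zero G]
    {g : F → G} {s : Set F} (hs : IsOpen s) (hg : ContinuousOn g s) {γ : C(K, F)}
    (hγ : ∀ t, γ t ∈ s) (t : K) : nemytskii g γ t = g (γ t) := by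
  have h : Continuous (g ∘ γ) := continuous_iff_continuousAt.2 fun t ↦
    (hg.continuousAt (hs.mem_nhds (hγ t))).comp γ.continuous.continuousAt
  simp [nemytskii, dif_pos h]

variable [CompactSpace K]

theorem exists_uniform_modulus_along {F G : Type*} [PseudoMetricSpace F] [PseudoMetricSpace G]
    {g : F → G} {s : Set F} (hs : IsOpen s) (hg : ContinuousOn g s) {γ : C(K, F)}
    (hγ : ∀ t, γ t ∈ s) {ε : ℝ} (hε : 0 < ε) :
    ∃ δ > 0, ∀ t y, dist y (γ t) < δ → y ∈ s ∧ dist (g y) (g (γ t)) < ε := by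
  have hK : IsCompact (range γ) := isCompact_range γ.continuous
  have hsub : range γ ⊆ s := by rintro _ ⟨t, rfl⟩; exact hγ t
  obtain ⟨δ₁, hδ₁, h₁⟩ := hK.exists_thickening_subset_open hs hsub
  have h₂ := hK.uniformContinuousAt_of_continuousAt g
    (fun a ha ↦ hg.continuousAt (hs.mem_nhds (hsub ha))) (Metric.dist_mem_uniformity hε)
  obtain ⟨δ₂, hδ₂, h₂⟩ := Metric.mem_uniformity_dist.1 h₂
  refine ⟨min δ₁ δ₂, lt_min hδ₁ hδ₂, fun t y hy ↦ ⟨h₁ ?_, ?_⟩⟩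
  · exact Metric.mem_thickening_iff.2 ⟨γ t, mem_range_self t, hy.trans_le (min_le_left _ _)⟩
  · have := h₂ (a := γ t) (b := y) (by rw [dist_comm]; exact hy.trans_le (min_le_right _ _))
      (mem_range_self t)
    rw [dist_comm]
    exact this

theorem continuousOn_nemytskii {F G : Type*} [NormedAddCommGroup F] [NormedAddCommGroup G]
    {g : F → G} {s : Set F} (hs : IsOpen s) (hg : ContinuousOn g s) :
    ContinuousOn (nemytskii g) {γ : C(K, F) | ∀ t, γ t ∈ s} := by
  intro γ hγ
  apply ContinuousAt.continuousWithinAt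
  rw [Metric.continuousAt_iff]
  intro ε hε
  obtain ⟨δ, hδ, h⟩ := exists_uniform_modulus_along hs hg hγ (half_pos hε)
  refine ⟨δ, hδ, fun {η} hη ↦ ?_⟩
  have hd : ∀ t, dist (η t) (γ t) < δ := fun t ↦ (ContinuousMap.dist_apply_le_dist t).trans_lt hη
  refine lt_of_le_of_lt ?_ (half_lt_self hε)
  rw [ContinuousMap.dist_le (half_pos hε).le]
  intro t
  rw [nemytskii_apply hs hg hγ, nemytskii_apply hs hg fun t ↦ (h t _ (hd t)).1]
  exact (h t _ (hd t)).2.le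

variable {F G : Type*} [NormedAddCommGroup F] [NormedSpace ℝ F] [NormedAddCommGroup G]
  [NormedSpace ℝ G]

variable (K F G) in
/-- Pointwise application `(A, h) ↦ (t ↦ A t (h t))` as a continuous bilinear map. -/
noncomputable def pointwiseApply : C(K, F →L[ℝ] G) →L[ℝ] C(K, F) →L[ℝ] C(K, G) :=
  LinearMap.mkContinuous₂
    (LinearMap.mk₂ ℝ (fun (A : C(K, F →L[ℝ] G)) (h : C(K, F)) ↦
        (⟨fun t ↦ A t (h t), A.continuous.clm_apply h.continuous⟩ : C(K, G)))
      (fun _ _ _ ↦ by ext; simp) (fun _ _ _ ↦ by ext; simp) (fun _ _ _ ↦ by ext; simp)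
      (fun _ _ _ ↦ by ext; simp)) 1
    (fun A h ↦ by
      rw [one_mul, ContinuousMap.norm_le _ (by positivity)]
      intro t
      exact ((A t).le_opNorm _).trans (mul_le_mul (A.norm_coe_le_norm t) (h.norm_coe_le_norm t)
        (norm_nonneg (h t)) (norm_nonneg A)))

@[simp] theorem pointwiseApply_apply (A : C(K, F →L[ℝ] G)) (h : C(K, F)) (t : K) :
    pointwiseApply K F G A h t = A t (h t) := rfl

theorem hasFDerivAt_nemytskii {g : F → G} {s : Set F} (hs : IsOpen s) (hg : ContDiffOn ℝ 1 g s)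
    {γ : C(K, F)} (hγ : ∀ t, γ t ∈ s) :
    HasFDerivAt (nemytskii g) (pointwiseApply K F G (nemytskii (fderiv ℝ g) γ)) γ := by
  have hg' : ContinuousOn (fderiv ℝ g) s := hg.continuousOn_fderiv_of_isOpen hs le_rfl
  rw [hasFDerivAt_iff_isLittleO, Asymptotics.isLittleO_iff]
  intro ε hε
  obtain ⟨δ, hδ, h⟩ := exists_uniform_modulus_along hs hg' hγ hε
  filter_upwards [Metric.ball_mem_nhds γ hδ] with η hη
  have hd : ∀ t, dist (η t) (γ t) < δ := fun t ↦ (ContinuousMap.dist_apply_le_dist t).trans_lt hη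
  rw [ContinuousMap.norm_le _ (by positivity)]
  intro t
  simp only [ContinuousMap.sub_apply, pointwiseApply_apply]
  rw [nemytskii_apply hs hg.continuousOn hγ, nemytskii_apply hs hg' hγ,
    nemytskii_apply hs hg.continuousOn fun t ↦ (h t _ (hd t)).1]
  have key := (convex_ball (γ t) δ).norm_image_sub_le_of_norm_hasFDerivWithin_le' (f := g)
    (f' := fderiv ℝ g) (φ := fderiv ℝ g (γ t)) (C := ε) (x := γ t) (y := η t)
    (fun y hy ↦ ((hg.differentiableOn (by simp)).differentiableAt
      (hs.mem_nhds (h t y hy).1)).hasFDerivAt.hasFDerivWithinAt)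
    (fun y hy ↦ by rw [← dist_eq_norm]; exact (h t y hy).2.le)
    (Metric.mem_ball_self hδ) (hd t)
  refine key.trans (mul_le_mul_of_nonneg_left ?_ hε.le)
  exact (η - γ).norm_coe_le_norm t

end Nemytskii

theorem isOpen_setOf_forall_apply_mem {K F : Type*} [TopologicalSpace K] [CompactSpace K]
    [TopologicalSpace F] {s : Set F} (hs : IsOpen s) : IsOpen {γ : C(K, F) | ∀ t, γ t ∈ s} := by
  simpa [MapsTo] using ContinuousMap.isOpen_setOfPred_mapsTo (X := K) isCompact_univ hs

theorem contDiffOn_nemytskii_nat {K : Type*} [TopologicalSpace K] [CompactSpace K]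
    {F : Type u} [NormedAddCommGroup F] [NormedSpace ℝ F] (n : ℕ) :
    ∀ {G : Type u} [NormedAddCommGroup G] [NormedSpace ℝ G] {g : F → G} {s : Set F},
      IsOpen s → ContDiffOn ℝ n g s →
      ContDiffOn ℝ n (nemytskii g) {γ : C(K, F) | ∀ t, γ t ∈ s} := by
  induction n with
  | zero =>
    intro G _ _ g s hs hg
    simp only [CharP.cast_eq_zero, contDiffOn_zero] at hg ⊢
    exact continuousOn_nemytskii hs hg
  | succ n ih =>
    intro G _ _ g s hs hg
    have hS := isOpen_setOf_forall_apply_mem (K := K) hs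
    have hg1 : ContDiffOn ℝ 1 g s := hg.of_le (by exact_mod_cast Nat.le_add_left 1 n)
    have hg' : ContDiffOn ℝ n (fderiv ℝ g) s := hg.fderiv_of_isOpen hs (by norm_cast)
    push_cast
    rw [contDiffOn_succ_iff_fderiv_of_isOpen hS]
    refine ⟨fun γ hγ ↦ (hasFDerivAt_nemytskii hs hg1 hγ).differentiableAt.differentiableWithinAt,
      by simp, ?_⟩
    refine ((pointwiseApply K F G).contDiff.comp_contDiffOn (ih hs hg')).congr fun γ hγ ↦ ?_
    exact (hasFDerivAt_nemytskii hs hg1 hγ).fderiv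

theorem contDiffOn_nemytskii {K : Type*} [TopologicalSpace K] [CompactSpace K]
    {F G : Type u} [NormedAddCommGroup F] [NormedSpace ℝ F] [NormedAddCommGroup G]
    [NormedSpace ℝ G] {g : F → G} {s : Set F} (hs : IsOpen s) (hg : ContDiffOn ℝ ∞ g s) :
    ContDiffOn ℝ ∞ (nemytskii g) {γ : C(K, F) | ∀ t, γ t ∈ s} :=
  contDiffOn_infty.2 fun n ↦ contDiffOn_nemytskii_nat n hs (hg.of_le (by exact_mod_cast le_top))

/-- The inverse function theorem for smooth maps, with smoothness of the local inverse on its whole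
domain. -/
theorem ContDiffOn.exists_openPartialHomeomorph {F G : Type*} [NormedAddCommGroup F]
    [NormedSpace ℝ F] [CompleteSpace F] [NormedAddCommGroup G] [NormedSpace ℝ G]
    {f : F → G} {s : Set F} (hs : IsOpen s) (hf : ContDiffOn ℝ ∞ f s) {a : F} (ha : a ∈ s)
    {f' : F ≃L[ℝ] G} (hf' : HasFDerivAt f (f' : F →L[ℝ] G) a) :
    ∃ e : OpenPartialHomeomorph F G, ⇑e = f ∧ a ∈ e.source ∧ e.source ⊆ s ∧
      ContDiffOn ℝ ∞ e.symm e.target := by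
  have hfa : ContDiffAt ℝ ∞ f a := hf.contDiffAt (hs.mem_nhds ha)
  have hn : (∞ : WithTop ℕ∞) ≠ 0 := by simp
  set e₀ := hfa.toOpenPartialHomeomorph f hf' hn with he₀
  have he₀f : ⇑e₀ = f := hfa.toOpenPartialHomeomorph_coe hf' hn
  set t : Set F := s ∩ fderiv ℝ f ⁻¹' (range ((↑) : (F ≃L[ℝ] G) → F →L[ℝ] G)) with ht_def
  have ht : IsOpen t := (hf.continuousOn_fderiv_of_isOpen hs (by simp)).isOpen_inter_preimage hs
    ContinuousLinearEquiv.isOpen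
  have hat : a ∈ t := ⟨ha, f', hf'.fderiv.symm⟩
  refine ⟨e₀.restrOpen t ht, by simpa using he₀f, ?_, ?_, ?_⟩
  · simpa using ⟨hfa.mem_toOpenPartialHomeomorph_source hf' hn, hat⟩
  · simp only [OpenPartialHomeomorph.restrOpen_source]
    exact inter_subset_right.trans inter_subset_left
  · intro y hy
    have hy' := (e₀.restrOpen t ht).map_target hy
    rw [OpenPartialHomeomorph.restrOpen_source] at hy'
    obtain ⟨L, hL⟩ := hy'.2.2
    apply ContDiffAt.contDiffWithinAt
    have hd : ContDiffAt ℝ ∞ f ((e₀.restrOpen t ht).symm y) :=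
      hf.contDiffAt (hs.mem_nhds hy'.2.1)
    refine (e₀.restrOpen t ht).contDiffAt_symm (f₀' := L) hy ?_ ?_
    · rw [hL]
      simpa [he₀f] using (hd.differentiableAt hn).hasFDerivAt
    · simpa [he₀f] using hd

section SecondOrder

variable {E : Type u} [NormedAddCommGroup E] [NormedSpace ℝ E]

/-- The compact time interval `[-1, 2]`. -/
abbrev TimeInterval : Type := Icc (-1 : ℝ) 2

/-- The retraction of the real line onto `[-1, 2]`. -/
noncomputable def timeProj (t : ℝ) : TimeInterval := projIcc (-1) 2 (by norm_num) t

theorem continuous_timeProj : Continuous timeProj :=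
  continuous_projIcc (h := by norm_num)

theorem timeProj_coe {t : ℝ} (ht : t ∈ Ioo (-1 : ℝ) 2) : (timeProj t : ℝ) = t := by
  rw [timeProj, projIcc_of_mem _ (Ioo_subset_Icc_self ht)]

/-- The primitive vanishing at `0` of a continuous curve on `[-1, 2]`. -/
noncomputable def primitive : C(TimeInterval, E) →L[ℝ] C(TimeInterval, E) :=
  LinearMap.mkContinuous
    { toFun := fun u ↦ ⟨fun t ↦ ∫ s in (0 : ℝ)..t, u (timeProj s),
        (intervalIntegral.continuous_primitive (fun _ _ ↦
          (u.continuous.comp continuous_timeProj).intervalIntegrable _ _) 0).comp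
          continuous_subtype_val⟩
      map_add' := fun u v ↦ by
        ext t
        exact intervalIntegral.integral_add
          ((u.continuous.comp continuous_timeProj).intervalIntegrable _ _)
          ((v.continuous.comp continuous_timeProj).intervalIntegrable _ _)
      map_smul' := fun c u ↦ by
        ext t
        exact intervalIntegral.integral_smul c _ } 2
    (fun u ↦ by
      rw [ContinuousMap.norm_le _ (by positivity)]
      intro t
      have h := intervalIntegral.norm_integral_le_of_norm_le_const (a := (0 : ℝ)) (b := t)
        (f := fun s ↦ u (timeProj s)) (C := ‖u‖) (fun s _ ↦ u.norm_coe_le_norm _)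
      refine h.trans ?_
      rw [mul_comm]
      refine mul_le_mul_of_nonneg_right ?_ (norm_nonneg _)
      rw [sub_zero, abs_le]
      constructor <;> linarith [t.2.1, t.2.2])

theorem primitive_apply (u : C(TimeInterval, E)) (t : TimeInterval) :
    primitive u t = ∫ s in (0 : ℝ)..t, u (timeProj s) := rfl

theorem primitive_zero_time (u : C(TimeInterval, E)) : primitive u (timeProj 0) = 0 := by
  rw [primitive_apply, timeProj_coe (by norm_num), intervalIntegral.integral_same]

theorem primitive_const [CompleteSpace E] (c : E) :
    primitive (ContinuousMap.const TimeInterval c) (timeProj 1) = c := by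
  rw [primitive_apply, timeProj_coe (by norm_num)]
  simp

theorem hasDerivAt_primitive [CompleteSpace E] (u : C(TimeInterval, E)) {t : ℝ}
    (ht : t ∈ Ioo (-1 : ℝ) 2) :
    HasDerivAt (fun s ↦ primitive u (timeProj s)) (u (timeProj t)) t := by
  have h : HasDerivAt (fun r ↦ ∫ s in (0 : ℝ)..r, u (timeProj s)) (u (timeProj t)) t :=
    intervalIntegral.integral_hasDerivAt_right
      ((u.continuous.comp continuous_timeProj).intervalIntegrable _ _)
      (u.continuous.comp continuous_timeProj).aestronglyMeasurable.stronglyMeasurableAtFilter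
      (u.continuous.comp continuous_timeProj).continuousAt
  refine h.congr_of_eventuallyEq ?_
  filter_upwards [isOpen_Ioo.mem_nhds ht] with r hr
  rw [primitive_apply, timeProj_coe hr]

/-- Constant curves. -/
noncomputable def constCurve : E →L[ℝ] C(TimeInterval, E) :=
  LinearMap.mkContinuous
    { toFun := ContinuousMap.const _
      map_add' := fun _ _ ↦ rfl
      map_smul' := fun _ _ ↦ rfl } 1
    (fun c ↦ by
      rw [one_mul, ContinuousMap.norm_le _ (norm_nonneg _)]
      exact fun _ ↦ le_rfl)

@[simp] theorem constCurve_apply (c : E) (t : TimeInterval) : constCurve c t = c := rfl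

/-- The velocity of the curve with initial data `p` and acceleration `u`. -/
noncomputable def velocityCurve : (E × E) × C(TimeInterval, E) →L[ℝ] C(TimeInterval, E) :=
  constCurve ∘L .snd ℝ E E ∘L .fst ℝ _ _ + primitive ∘L .snd ℝ _ _

/-- The curve with initial data `p` and acceleration `u`. -/
noncomputable def positionCurve : (E × E) × C(TimeInterval, E) →L[ℝ] C(TimeInterval, E) :=
  constCurve ∘L .fst ℝ E E ∘L .fst ℝ _ _ + primitive ∘L velocityCurve

/-- The curve with initial data `p` and acceleration `u`, together with its velocity. -/
noncomputable def phaseCurve : (E × E) × C(TimeInterval, E) →L[ℝ] C(TimeInterval, E × E) :=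
  ContinuousLinearMap.compLeftContinuous ℝ TimeInterval (.inl ℝ E E) ∘L positionCurve +
    ContinuousLinearMap.compLeftContinuous ℝ TimeInterval (.inr ℝ E E) ∘L velocityCurve

theorem phaseCurve_apply (q : (E × E) × C(TimeInterval, E)) (t : TimeInterval) :
    phaseCurve q t = (positionCurve q t, velocityCurve q t) := by
  simp [phaseCurve]

theorem phaseCurve_zero_time (q : (E × E) × C(TimeInterval, E)) :
    phaseCurve q (timeProj 0) = q.1 := by
  rw [phaseCurve_apply]
  simp [positionCurve, velocityCurve, primitive_zero_time]

theorem phaseCurve_equilibrium (x : E) (t : TimeInterval) :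
    phaseCurve ((x, 0), (0 : C(TimeInterval, E))) t = (x, 0) := by
  rw [phaseCurve_apply]
  simp [positionCurve, velocityCurve]

theorem hasDerivAt_phaseCurve [CompleteSpace E] (q : (E × E) × C(TimeInterval, E)) {t : ℝ}
    (ht : t ∈ Ioo (-1 : ℝ) 2) :
    HasDerivAt (fun s ↦ phaseCurve q (timeProj s))
      ((phaseCurve q (timeProj t)).2, q.2 (timeProj t)) t := by
  simp only [phaseCurve_apply]
  refine HasDerivAt.prodMk ?_ ?_
  · exact (hasDerivAt_primitive (velocityCurve q) ht).const_add q.1.1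
  · exact (hasDerivAt_primitive q.2 ht).const_add q.1.2

theorem positionCurve_one_inl [CompleteSpace E] (p : E × E) :
    positionCurve (p, (0 : C(TimeInterval, E))) (timeProj 1) = p.1 + p.2 := by
  have : velocityCurve (p, (0 : C(TimeInterval, E))) = ContinuousMap.const _ p.2 := by
    ext t
    simp [velocityCurve]
  simp [positionCurve, this, primitive_const]

/-- Smooth dependence on initial data, up to time one, for a second order equation
`x'' = g (x, x')` near an equilibrium at which `g` vanishes to second order. -/
theorem exists_smooth_second_order_flow [CompleteSpace E] {g : E × E → E} {s : Set (E × E)}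
    (hs : IsOpen s) (hg : ContDiffOn ℝ ∞ g s) {x₀ : E} (hx₀ : (x₀, (0 : E)) ∈ s)
    (hg₀ : g (x₀, 0) = 0) (hg' : HasFDerivAt g (0 : E × E →L[ℝ] E) (x₀, 0)) :
    ∃ (W : Set (E × E)) (α : E × E → ℝ → E × E), IsOpen W ∧ (x₀, (0 : E)) ∈ W ∧
      (∀ p ∈ W, α p 0 = p) ∧
      (∀ p ∈ W, ∀ t ∈ Ioo (-1 : ℝ) 2,
        α p t ∈ s ∧ HasDerivAt (α p) ((α p t).2, g (α p t)) t) ∧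
      ContDiffOn ℝ ∞ (fun p ↦ (α p 1).1) W ∧
      HasFDerivAt (fun p ↦ (α p 1).1)
        (ContinuousLinearMap.fst ℝ E E + ContinuousLinearMap.snd ℝ E E) (x₀, 0) := by
  set a : (E × E) × C(TimeInterval, E) := ((x₀, 0), 0) with ha
  set f : (E × E) × C(TimeInterval, E) → (E × E) × C(TimeInterval, E) :=
    fun q ↦ (q.1, q.2 - nemytskii g (phaseCurve q)) with hf_def
  set D : Set ((E × E) × C(TimeInterval, E)) :=
    phaseCurve ⁻¹' {γ : C(TimeInterval, E × E) | ∀ t, γ t ∈ s} with hD_def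
  have hD : IsOpen D := (isOpen_setOf_forall_apply_mem hs).preimage phaseCurve.continuous
  have haD : a ∈ D := fun t ↦ by rw [phaseCurve_equilibrium]; exact hx₀
  have hphase : ContDiff ℝ ∞ (phaseCurve (E := E)) := ContinuousLinearMap.contDiff _
  have hf : ContDiffOn ℝ ∞ f D :=
    contDiff_fst.contDiffOn.prodMk (contDiff_snd.contDiffOn.sub
      ((contDiffOn_nemytskii hs hg).comp hphase.contDiffOn fun _ h ↦ h))
  have hfa : f a = a := by
    refine Prod.ext rfl ?_
    ext t
    simp [hf_def, nemytskii_apply hs hg.continuousOn haD, a, phaseCurve_equilibrium, hg₀]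
  have hg1 : ContDiffOn ℝ 1 g s := hg.of_le (by simp)
  have hzero : pointwiseApply TimeInterval (E × E) E (nemytskii (fderiv ℝ g) (phaseCurve a)) = 0 := by
    ext h t
    rw [pointwiseApply_apply,
      nemytskii_apply hs (hg1.continuousOn_fderiv_of_isOpen hs le_rfl) haD, phaseCurve_equilibrium,
      hg'.fderiv]
    rfl
  have hfd : HasFDerivAt f
      ((ContinuousLinearEquiv.refl ℝ ((E × E) × C(TimeInterval, E)) :) :
        ((E × E) × C(TimeInterval, E)) →L[ℝ] _) a := by
    have h1 := hasFDerivAt_nemytskii hs hg1 haD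
    rw [hzero] at h1
    have hphase' : HasFDerivAt (phaseCurve (E := E)) phaseCurve a :=
      ContinuousLinearMap.hasFDerivAt _
    have h2 := hasFDerivAt_fst (𝕜 := ℝ) (p := a) |>.prodMk
      ((hasFDerivAt_snd (𝕜 := ℝ) (p := a)).sub (h1.comp a hphase'))
    refine h2.congr_fderiv ?_
    ext <;> simp
  obtain ⟨e, hef, hae, heD, hes⟩ := hf.exists_openPartialHomeomorph hD haD hfd
  have hat : a ∈ e.target := by
    have := e.map_source hae
    rwa [hef, hfa] at this
  have hea : e.symm a = a := by
    have := e.left_inv hae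
    rwa [hef, hfa] at this
  set j : E × E →L[ℝ] (E × E) × C(TimeInterval, E) := .inl ℝ _ _ with hj
  set W : Set (E × E) := j ⁻¹' e.target with hW
  have hfst : ∀ p ∈ W, (e.symm (j p)).1 = p := fun p hp ↦ by
    have := e.right_inv hp
    rw [hef] at this
    exact congrArg Prod.fst this
  have hsolve : ∀ p ∈ W, (e.symm (j p)).2 = nemytskii g (phaseCurve (e.symm (j p))) := fun p hp ↦ by
    have := e.right_inv hp
    rw [hef] at this
    exact sub_eq_zero.1 (congrArg Prod.snd this)
  let ev : (E × E) × C(TimeInterval, E) →L[ℝ] E :=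
    ContinuousMap.evalCLM ℝ (timeProj 1) ∘L positionCurve
  have hev : (fun p ↦ (phaseCurve (e.symm (j p)) (timeProj 1)).1) = fun p ↦ ev (e.symm (j p)) := by
    ext p
    rw [phaseCurve_apply]
    rfl
  refine ⟨W, fun p t ↦ phaseCurve (e.symm (j p)) (timeProj t), e.open_target.preimage j.continuous,
    hat, fun p hp ↦ (phaseCurve_zero_time _).trans (hfst p hp), fun p hp t ht ↦ ?_, ?_, ?_⟩
  · have hmem : e.symm (j p) ∈ D := heD (e.map_target hp)
    refine ⟨hmem _, ?_⟩
    have h := hasDerivAt_phaseCurve (e.symm (j p)) ht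
    have hU : (e.symm (j p)).2 (timeProj t) = g (phaseCurve (e.symm (j p)) (timeProj t)) := by
      rw [hsolve p hp, nemytskii_apply hs hg.continuousOn hmem]
    rwa [hU] at h
  · rw [hev]
    exact ev.contDiff.comp_contDiffOn (hes.comp j.contDiff.contDiffOn fun _ h ↦ h)
  · rw [hev]
    have hsd : HasFDerivAt e.symm
        ((ContinuousLinearEquiv.refl ℝ ((E × E) × C(TimeInterval, E))).symm :
          ((E × E) × C(TimeInterval, E)) →L[ℝ] _) a := by
      refine e.hasFDerivAt_symm hat ?_
      rw [hea, hef]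
      exact hfd
    have h := ev.hasFDerivAt.comp (x₀, (0 : E)) (hsd.comp (x₀, (0 : E)) j.hasFDerivAt)
    refine h.congr_fderiv ?_
    ext p <;> simp [ev, hj, positionCurve_one_inl]

end SecondOrder

section TangentChart

variable {E : Type*} [NormedAddCommGroup E] [NormedSpace ℝ E]
  {M : Type*} [TopologicalSpace M] [ChartedSpace E M] [IsManifold 𝓘(ℝ, E) ∞ M]

/-- The chart of the tangent bundle induced by the preferred chart of `M` at `x`. -/
noncomputable def tangentChart (x : M) : PartialEquiv (TangentBundle 𝓘(ℝ, E) M) (E × E) :=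
  extChartAt 𝓘(ℝ, E).tangent (⟨x, 0⟩ : TangentBundle 𝓘(ℝ, E) M)

theorem mem_tangentChart_source {x : M} {w : TangentBundle 𝓘(ℝ, E) M} :
    w ∈ (tangentChart x).source ↔ w.proj ∈ (chartAt E x).source := by
  rw [tangentChart, extChartAt_source]
  exact TangentBundle.mem_chart_source_iff _ _

theorem mem_tangentChart_target {x : M} {p : E × E} :
    p ∈ (tangentChart x).target ↔ p.1 ∈ (chartAt E x).target := by
  rw [tangentChart, FiberBundle.extChartAt_target]
  simp +contextual

theorem isOpen_tangentChart_source (x : M) :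
    IsOpen (tangentChart x : PartialEquiv (TangentBundle 𝓘(ℝ, E) M) (E × E)).source :=
  isOpen_extChartAt_source _

theorem isOpen_tangentChart_target (x : M) :
    IsOpen (tangentChart x : PartialEquiv (TangentBundle 𝓘(ℝ, E) M) (E × E)).target :=
  isOpen_extChartAt_target _

theorem contMDiffOn_tangentChart (x : M) :
    ContMDiffOn 𝓘(ℝ, E).tangent 𝓘(ℝ, E × E) ∞ (tangentChart x)
      (tangentChart x : PartialEquiv (TangentBundle 𝓘(ℝ, E) M) (E × E)).source := by
  rw [tangentChart, extChartAt_source]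
  exact contMDiffOn_extChartAt

theorem contMDiffOn_tangentChart_symm (x : M) :
    ContMDiffOn 𝓘(ℝ, E × E) 𝓘(ℝ, E).tangent ∞
      (tangentChart x : PartialEquiv (TangentBundle 𝓘(ℝ, E) M) (E × E)).symm
      (tangentChart x : PartialEquiv (TangentBundle 𝓘(ℝ, E) M) (E × E)).target :=
  contMDiffOn_extChartAt_symm _

theorem tangentChart_apply {x : M} {w : TangentBundle 𝓘(ℝ, E) M}
    (hw : w ∈ (tangentChart x).source) :
    tangentChart x w = (extChartAt 𝓘(ℝ, E) x w.proj,
      mfderiv 𝓘(ℝ, E) 𝓘(ℝ, E) (extChartAt 𝓘(ℝ, E) x) w.proj w.snd) := by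
  have hw' := mem_tangentChart_source.1 hw
  rw [← TangentBundle.continuousLinearMapAt_trivializationAt hw', tangentChart,
    FiberBundle.extChartAt]
  refine Prod.ext rfl ?_
  exact (Bundle.Trivialization.continuousLinearMapAt_apply_of_mem ℝ
    (trivializationAt E (TangentSpace 𝓘(ℝ, E)) x) hw' _).symm

theorem tangentChart_symm_proj {x : M} {p : E × E} (hp : p ∈ (tangentChart x).target) :
    ((tangentChart x).symm p).proj = (extChartAt 𝓘(ℝ, E) x).symm p.1 := by
  have h := (tangentChart x).right_inv hp
  have hs := (tangentChart x).map_target hp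
  rw [tangentChart_apply hs] at h
  rw [← congrArg Prod.fst h, (extChartAt 𝓘(ℝ, E) x).left_inv]
  rw [extChartAt_source]
  exact mem_tangentChart_source.1 hs

theorem tangentChart_fibreScale {x : M} {w : TangentBundle 𝓘(ℝ, E) M}
    (hw : w ∈ (tangentChart x).source) (c : ℝ) :
    fibreScale 𝓘(ℝ, E) c w ∈ (tangentChart x).source ∧
      tangentChart x (fibreScale 𝓘(ℝ, E) c w) =
        ((tangentChart x w).1, c • (tangentChart x w).2) := by
  have hcw : fibreScale 𝓘(ℝ, E) c w ∈ (tangentChart x).source :=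
    mem_tangentChart_source.2 (mem_tangentChart_source.1 hw)
  refine ⟨hcw, ?_⟩
  rw [tangentChart_apply hw, tangentChart_apply hcw]
  exact Prod.ext rfl (map_smul _ _ _)

theorem tangentChart_zero (x : M) :
    tangentChart x (⟨x, 0⟩ : TangentBundle 𝓘(ℝ, E) M) = (extChartAt 𝓘(ℝ, E) x x, 0) := by
  rw [tangentChart_apply (mem_tangentChart_source.2 (mem_chart_source E x))]
  exact Prod.ext rfl (map_zero _)

theorem contMDiff_fibreScale (c : ℝ) :
    ContMDiff 𝓘(ℝ, E).tangent 𝓘(ℝ, E).tangent ∞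
      (fibreScale 𝓘(ℝ, E) c : TangentBundle 𝓘(ℝ, E) M → TangentBundle 𝓘(ℝ, E) M) := by
  intro w
  have hw : w ∈ (tangentChart w.proj).source :=
    mem_tangentChart_source.2 (mem_chart_source E w.proj)
  have h : ContMDiffAt 𝓘(ℝ, E).tangent 𝓘(ℝ, E × E) ∞
      (fun v ↦ ((tangentChart w.proj v).1, c • (tangentChart w.proj v).2)) w := by
    have h0 : ContDiff ℝ ∞ (fun p : E × E ↦ (p.1, c • p.2)) :=
      contDiff_fst.prodMk (contDiff_snd.const_smul c)
    exact h0.contMDiff.contMDiffAt.comp w ((contMDiffOn_tangentChart w.proj).contMDiffAt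
      ((isOpen_tangentChart_source _).mem_nhds hw))
  have h2 : ContMDiffAt 𝓘(ℝ, E × E) 𝓘(ℝ, E).tangent ∞ (tangentChart w.proj).symm
      ((tangentChart w.proj w).1, c • (tangentChart w.proj w).2) := by
    refine (contMDiffOn_tangentChart_symm w.proj).contMDiffAt
      ((isOpen_tangentChart_target _).mem_nhds ?_)
    exact mem_tangentChart_target.2
      (mem_tangentChart_target.1 ((tangentChart w.proj).map_source hw))
  refine (h2.comp w h).congr_of_eventuallyEq ?_
  filter_upwards [(isOpen_tangentChart_source w.proj).mem_nhds hw] with v hv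
  have := tangentChart_fibreScale hv c
  rw [Function.comp_apply, ← this.2, (tangentChart w.proj).left_inv this.1]

/-- The derivative of `tangentChart x`. -/
noncomputable def tangentChartDeriv (x : M) (w : TangentBundle 𝓘(ℝ, E) M) :
    TangentSpace 𝓘(ℝ, E).tangent w →L[ℝ] E × E :=
  mfderiv 𝓘(ℝ, E).tangent 𝓘(ℝ, E × E) (tangentChart x) w

theorem hasMFDerivAt_tangentChart {x : M} {w : TangentBundle 𝓘(ℝ, E) M}
    (hw : w ∈ (tangentChart x).source) :
    HasMFDerivAt 𝓘(ℝ, E).tangent 𝓘(ℝ, E × E) (tangentChart x) w (tangentChartDeriv x w) :=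
  (((contMDiffOn_tangentChart x).contMDiffAt
    ((isOpen_tangentChart_source x).mem_nhds hw)).mdifferentiableAt (by simp)).hasMFDerivAt

theorem tangentChartDeriv_injective {x : M} {w : TangentBundle 𝓘(ℝ, E) M}
    (hw : w ∈ (tangentChart x).source) : Function.Injective (tangentChartDeriv x w) :=
  (isInvertible_mfderiv_extChartAt (I := 𝓘(ℝ, E).tangent) hw).injective

theorem fst_tangentChartDeriv {x : M} {w : TangentBundle 𝓘(ℝ, E) M}
    (hw : w ∈ (tangentChart x).source) (ξ : TangentSpace 𝓘(ℝ, E).tangent w) :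
    (tangentChartDeriv x w ξ).1 = mfderiv 𝓘(ℝ, E) 𝓘(ℝ, E) (extChartAt 𝓘(ℝ, E) x) w.proj
      (mfderiv 𝓘(ℝ, E).tangent 𝓘(ℝ, E) (fun v : TangentBundle 𝓘(ℝ, E) M ↦ v.proj) w ξ) := by
  have h1 : HasMFDerivAt 𝓘(ℝ, E).tangent 𝓘(ℝ, E) (fun v ↦ (tangentChart x v).1) w
      ((ContinuousLinearMap.fst ℝ E E).comp (tangentChartDeriv x w)) :=
    ((ContinuousLinearMap.fst ℝ E E).hasMFDerivAt (x := tangentChart x w)).comp w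
      (hasMFDerivAt_tangentChart hw)
  have hπ : MDifferentiableAt 𝓘(ℝ, E).tangent 𝓘(ℝ, E)
      (fun v : TangentBundle 𝓘(ℝ, E) M ↦ v.proj) w :=
    (Bundle.contMDiff_proj (TangentSpace 𝓘(ℝ, E)) (n := ∞)).mdifferentiableAt (by simp)
  have h2 := ((mdifferentiableAt_extChartAt (I := 𝓘(ℝ, E)) (x := x)
    (mem_tangentChart_source.1 hw)).hasMFDerivAt).comp w hπ.hasMFDerivAt
  have h3 : HasMFDerivAt 𝓘(ℝ, E).tangent 𝓘(ℝ, E) (fun v ↦ (tangentChart x v).1) w _ :=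
    h2.congr_of_eventuallyEq (by
      filter_upwards [(isOpen_tangentChart_source x).mem_nhds hw] with v hv
      rw [tangentChart_apply hv]; rfl)
  exact congrArg (fun L ↦ L ξ) (hasMFDerivAt_unique h1 h3)

theorem tangentChartDeriv_fibreScale {x : M} {w : TangentBundle 𝓘(ℝ, E) M}
    (hw : w ∈ (tangentChart x).source) (c : ℝ) (ξ : TangentSpace 𝓘(ℝ, E).tangent w) :
    tangentChartDeriv x (fibreScale 𝓘(ℝ, E) c w)
        (mfderiv 𝓘(ℝ, E).tangent 𝓘(ℝ, E).tangent (fibreScale 𝓘(ℝ, E) c) w ξ) =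
      ((tangentChartDeriv x w ξ).1, c • (tangentChartDeriv x w ξ).2) := by
  have h1 := (hasMFDerivAt_tangentChart (tangentChart_fibreScale hw c).1).comp w
    ((contMDiff_fibreScale c).mdifferentiableAt (x := w) (by simp)).hasMFDerivAt
  let L : E × E →L[ℝ] E × E :=
    (ContinuousLinearMap.fst ℝ E E).prod (c • ContinuousLinearMap.snd ℝ E E)
  have h2 : HasMFDerivAt 𝓘(ℝ, E).tangent 𝓘(ℝ, E × E) (fun v ↦ L (tangentChart x v)) w
      (L.comp (tangentChartDeriv x w)) :=
    (L.hasMFDerivAt (x := tangentChart x w)).comp w (hasMFDerivAt_tangentChart hw)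
  have h3 := h2.congr_of_eventuallyEq (f₁ := tangentChart x ∘ fibreScale 𝓘(ℝ, E) c) (by
      filter_upwards [(isOpen_tangentChart_source x).mem_nhds hw] with v hv
      exact (tangentChart_fibreScale hv c).2)
  exact congrArg (fun L ↦ L ξ) (hasMFDerivAt_unique h1 h3)

end TangentChart

section PartialDiffeomorph

/-- Every extended chart of a boundaryless manifold is a partial diffeomorphism. -/
theorem exists_partialDiffeomorph_extChartAt {E H M : Type*} [NormedAddCommGroup E]
    [NormedSpace ℝ E] [TopologicalSpace H] (I : ModelWithCorners ℝ E H) [I.Boundaryless]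
    [TopologicalSpace M] [ChartedSpace H M] [IsManifold I ∞ M] (x : M) :
    ∃ Φ : PartialDiffeomorph I 𝓘(ℝ, E) M E ∞, Φ.toPartialEquiv = extChartAt I x :=
  ⟨{ toPartialEquiv := extChartAt I x
     open_source := isOpen_extChartAt_source x
     open_target := isOpen_extChartAt_target x
     contMDiffOn_toFun := by
       rw [extChartAt_source]
       exact contMDiffOn_extChartAt
     contMDiffOn_invFun := contMDiffOn_extChartAt_symm x }, rfl⟩

theorem PartialDiffeomorph.mem_trans_source {E F G H₁ H₂ H₃ M N P : Type*} [NormedAddCommGroup E]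
    [NormedSpace ℝ E] [NormedAddCommGroup F] [NormedSpace ℝ F] [NormedAddCommGroup G]
    [NormedSpace ℝ G] [TopologicalSpace H₁] [TopologicalSpace H₂] [TopologicalSpace H₃]
    {I : ModelWithCorners ℝ E H₁} {J : ModelWithCorners ℝ F H₂} {K : ModelWithCorners ℝ G H₃}
    [TopologicalSpace M] [ChartedSpace H₁ M] [TopologicalSpace N] [ChartedSpace H₂ N]
    [TopologicalSpace P] [ChartedSpace H₃ P] {n : WithTop ℕ∞}
    {Φ : PartialDiffeomorph I J M N n} {Ψ : PartialDiffeomorph J K N P n} {v : M} :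
    v ∈ (Φ.trans Ψ).source ↔ v ∈ Φ.source ∧ Φ v ∈ Ψ.source := Iff.rfl

/-- A local homeomorphism of normed spaces which is smooth in both directions is a partial
diffeomorphism. -/
theorem OpenPartialHomeomorph.exists_partialDiffeomorph {E F : Type*} [NormedAddCommGroup E]
    [NormedSpace ℝ E] [NormedAddCommGroup F] [NormedSpace ℝ F] (e : OpenPartialHomeomorph E F)
    (h : ContDiffOn ℝ ∞ e e.source) (h' : ContDiffOn ℝ ∞ e.symm e.target) :
    ∃ Φ : PartialDiffeomorph 𝓘(ℝ, E) 𝓘(ℝ, F) E F ∞, Φ.toPartialEquiv = e.toPartialEquiv :=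
  ⟨{ toPartialEquiv := e.toPartialEquiv
     open_source := e.open_source
     open_target := e.open_target
     contMDiffOn_toFun := h.contMDiffOn
     contMDiffOn_invFun := h'.contMDiffOn }, rfl⟩

end PartialDiffeomorph

/-- The derivative of a function which vanishes on `E × {0}` and is quadratic in the second variable
is zero at the points of `E × {0}`. -/
theorem hasFDerivAt_zero_of_quadratic {E F : Type*} [NormedAddCommGroup E] [NormedSpace ℝ E]
    [NormedAddCommGroup F] [NormedSpace ℝ F] {g : E × E → F} {V : Set E} (hV : IsOpen V) {x₀ : E}
    (hx₀ : x₀ ∈ V) (hg : DifferentiableAt ℝ g (x₀, 0))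
    (hq : ∀ x ∈ V, ∀ (c : ℝ) (v : E), g (x, c • v) = c ^ 2 • g (x, v)) :
    HasFDerivAt g (0 : E × E →L[ℝ] F) (x₀, 0) := by
  have hz : ∀ x ∈ V, g (x, 0) = 0 := fun x hx ↦ by simpa using hq x hx 0 0
  have h := hg.hasFDerivAt
  have h1 : (fderiv ℝ g (x₀, 0)).comp (.inl ℝ E E) = 0 := by
    have hc : HasFDerivAt (fun x : E ↦ g (x, 0)) ((fderiv ℝ g (x₀, 0)).comp (.inl ℝ E E)) x₀ :=
      HasFDerivAt.comp (f := fun x : E ↦ (x, (0 : E))) x₀ h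
        ((hasFDerivAt_id x₀).prodMk (hasFDerivAt_const (0 : E) x₀))
    refine hc.unique ((hasFDerivAt_const (0 : F) x₀).congr_of_eventuallyEq ?_)
    filter_upwards [hV.mem_nhds hx₀] with x hx using hz x hx
  have h2 : ∀ v : E, fderiv ℝ g (x₀, 0) (0, v) = 0 := fun v ↦ by
    have hl : HasDerivAt (fun c : ℝ ↦ (x₀, c • v)) (0, v) 0 := by
      simpa using (hasDerivAt_const (0 : ℝ) x₀).prodMk ((hasDerivAt_id (0 : ℝ)).smul_const v)
    have hc : HasDerivAt (fun c : ℝ ↦ g (x₀, c • v)) (fderiv ℝ g (x₀, 0) (0, v)) 0 := by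
      refine HasFDerivAt.comp_hasDerivAt (0 : ℝ) (f := fun c : ℝ ↦ (x₀, c • v)) ?_ hl
      simpa using h
    have hc' : HasDerivAt (fun c : ℝ ↦ g (x₀, c • v)) 0 0 := by
      simp only [hq x₀ hx₀]
      simpa using ((hasDerivAt_id (0 : ℝ)).pow 2).smul_const (g (x₀, v))
    exact hc.unique hc'
  refine h.congr_fderiv ?_
  ext v
  · exact congrArg (fun L ↦ L v) h1
  · exact h2 v

section LocalExponential

variable {E : Type u} [NormedAddCommGroup E] [NormedSpace ℝ E]
  {M : Type*} [TopologicalSpace M] [ChartedSpace E M] [IsManifold 𝓘(ℝ, E) ∞ M]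

theorem t2Space_tangentBundle [T2Space M] : T2Space (TangentBundle 𝓘(ℝ, E) M) := by
  rw [t2Space_iff_disjoint_nhds]
  intro v w hvw
  by_cases h : v.proj = w.proj
  · have hv : v ∈ (tangentChart v.proj).source :=
      mem_tangentChart_source.2 (mem_chart_source E v.proj)
    have hw : w ∈ (tangentChart v.proj).source :=
      mem_tangentChart_source.2 (h ▸ mem_chart_source E v.proj)
    have hc := (contMDiffOn_tangentChart (E := E) (M := M) v.proj).continuousOn
    have hO := isOpen_tangentChart_source (E := E) (M := M) v.proj
    refine (hc.continuousAt (hO.mem_nhds hv)).disjoint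
      (disjoint_nhds_nhds.2 fun h' ↦ hvw ?_) (hc.continuousAt (hO.mem_nhds hw))
    exact (tangentChart v.proj).injOn hv hw h'
  · have hc : Continuous (fun v : TangentBundle 𝓘(ℝ, E) M ↦ v.proj) :=
      (Bundle.contMDiff_proj (IB := 𝓘(ℝ, E)) (TangentSpace 𝓘(ℝ, E)) (n := ∞)).continuous
    exact hc.continuousAt.disjoint (disjoint_nhds_nhds.2 h) hc.continuousAt

/-- A vector field on the tangent bundle, read in the chart `tangentChart x`. -/
noncomputable def chartField (S : (v : TangentBundle 𝓘(ℝ, E) M) → TangentSpace 𝓘(ℝ, E).tangent v)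
    (x : M) (p : E × E) : E × E :=
  tangentChartDeriv x ((tangentChart x).symm p) (S ((tangentChart x).symm p))

variable {S : (v : TangentBundle 𝓘(ℝ, E) M) → TangentSpace 𝓘(ℝ, E).tangent v}

theorem trivializationAt_snd_eq_tangentChartDeriv {x : M} {w : TangentBundle 𝓘(ℝ, E) M}
    (hw : w ∈ (tangentChart x).source) (ξ : TangentSpace 𝓘(ℝ, E).tangent w) :
    (trivializationAt (E × E)
      (TangentSpace 𝓘(ℝ, E).tangent : TangentBundle 𝓘(ℝ, E) M → Type _) ⟨x, 0⟩ ⟨w, ξ⟩).2 =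
        tangentChartDeriv x w ξ := by
  have hw' : w ∈ (chartAt (ModelProd E E) (⟨x, 0⟩ : TangentBundle 𝓘(ℝ, E) M)).source := by
    rwa [tangentChart, extChartAt_source] at hw
  rw [tangentChartDeriv, tangentChart, ← TangentBundle.continuousLinearMapAt_trivializationAt hw']
  exact (Bundle.Trivialization.continuousLinearMapAt_apply_of_mem ℝ
    (trivializationAt (E × E)
      (TangentSpace 𝓘(ℝ, E).tangent : TangentBundle 𝓘(ℝ, E) M → Type _) ⟨x, 0⟩) hw' _).symm

theorem IsSpray.contDiffOn_chartField (hS : IsSpray 𝓘(ℝ, E) S) (x : M) :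
    ContDiffOn ℝ ∞ (chartField S x)
      (tangentChart x : PartialEquiv (TangentBundle 𝓘(ℝ, E) M) (E × E)).target := by
  have h := hS.smooth.comp_contMDiffOn (contMDiffOn_tangentChart_symm x)
  have h2 := ((trivializationAt (E × E)
    (TangentSpace 𝓘(ℝ, E).tangent : TangentBundle 𝓘(ℝ, E) M → Type _) ⟨x, 0⟩).contMDiffOn_iff
      (fun p hp ↦ by
        have := (tangentChart x).map_target hp
        rw [tangentChart, extChartAt_source] at this
        exact this)).1 h
  rw [← contMDiffOn_iff_contDiffOn]
  refine h2.2.congr fun p hp ↦ ?_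
  exact (trivializationAt_snd_eq_tangentChartDeriv ((tangentChart x).map_target hp) _).symm

theorem IsSpray.chartField_fst (hS : IsSpray 𝓘(ℝ, E) S) {x : M} {p : E × E}
    (hp : p ∈ (tangentChart x : PartialEquiv (TangentBundle 𝓘(ℝ, E) M) (E × E)).target) :
    (chartField S x p).1 = p.2 := by
  have hs := (tangentChart x).map_target hp
  rw [chartField, fst_tangentChartDeriv hs, hS.lifts_id]
  have := tangentChart_apply hs
  rw [(tangentChart x).right_inv hp] at this
  exact (congrArg Prod.snd this).symm

theorem IsSpray.chartField_smul (hS : IsSpray 𝓘(ℝ, E) S) {x : M} {p : E × E}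
    (hp : p ∈ (tangentChart x : PartialEquiv (TangentBundle 𝓘(ℝ, E) M) (E × E)).target) (c : ℝ) :
    (chartField S x (p.1, c • p.2)).2 = c ^ 2 • (chartField S x p).2 := by
  have hs := (tangentChart x).map_target hp
  obtain ⟨h1, h2⟩ := tangentChart_fibreScale hs c
  rw [(tangentChart x).right_inv hp] at h2
  have h3 : (tangentChart x).symm (p.1, c • p.2) =
      fibreScale 𝓘(ℝ, E) c ((tangentChart x).symm p) := by
    rw [← h2, (tangentChart x).left_inv h1]
  rw [chartField, h3, hS.homogeneous, tangentChartDeriv_fibreScale hs, map_smul, chartField,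
    pow_two, mul_smul]
  rfl

theorem hasMFDerivAt_tangentChart_symm_comp {x : M} {β : ℝ → E × E} {t : ℝ}
    (ht : β t ∈ (tangentChart x : PartialEquiv (TangentBundle 𝓘(ℝ, E) M) (E × E)).target)
    (hβ : HasDerivAt β (chartField S x (β t)) t) :
    HasMFDerivAt 𝓘(ℝ, ℝ) 𝓘(ℝ, E).tangent (fun s ↦ (tangentChart x).symm (β s)) t
      ((1 : ℝ →L[ℝ] ℝ).smulRight (S ((tangentChart x).symm (β t)))) := by
  have h1 : HasMFDerivAt 𝓘(ℝ, E × E) 𝓘(ℝ, E).tangent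
      (tangentChart x : PartialEquiv (TangentBundle 𝓘(ℝ, E) M) (E × E)).symm (β t)
      (mfderiv 𝓘(ℝ, E × E) 𝓘(ℝ, E).tangent (tangentChart x).symm (β t)) :=
    (((contMDiffOn_tangentChart_symm x).contMDiffAt
      ((isOpen_tangentChart_target x).mem_nhds ht)).mdifferentiableAt (by simp)).hasMFDerivAt
  have h2 := h1.comp t hβ.hasFDerivAt.hasMFDerivAt
  have h3 := mfderivWithin_extChartAt_symm_comp_mfderiv_extChartAt (I := 𝓘(ℝ, E).tangent)
    (x := (⟨x, 0⟩ : TangentBundle 𝓘(ℝ, E) M)) ht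
  have hr : range 𝓘(ℝ, E).tangent = univ := ModelWithCorners.range_eq_univ _
  rw [hr, mfderivWithin_univ] at h3
  refine h2.congr_mfderiv ?_
  have h4 : mfderiv 𝓘(ℝ, E × E) 𝓘(ℝ, E).tangent (tangentChart x).symm (β t)
      (chartField S x (β t)) = S ((tangentChart x).symm (β t)) :=
    congrArg (fun L ↦ L (S ((tangentChart x).symm (β t)))) h3
  refine ContinuousLinearMap.ext fun (r : ℝ) ↦ ?_
  change mfderiv 𝓘(ℝ, E × E) 𝓘(ℝ, E).tangent (tangentChart x).symm (β t)
      (r • chartField S x (β t)) = r • S ((tangentChart x).symm (β t))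
  rw [← h4]
  exact map_smul _ _ _

/-- Near the origin of each tangent space, the map `(π, exp)` of a spray is a diffeomorphism. -/
theorem IsSpray.exists_partialDiffeomorph [CompleteSpace E] [T2Space M]
    (hS : IsSpray 𝓘(ℝ, E) S) (x : M) :
    ∃ Φ : PartialDiffeomorph 𝓘(ℝ, E).tangent (𝓘(ℝ, E).prod 𝓘(ℝ, E)) (TangentBundle 𝓘(ℝ, E) M)
        (M × M) ∞,
      (⟨x, 0⟩ : TangentBundle 𝓘(ℝ, E) M) ∈ Φ.source ∧ Φ.source ⊆ sprayExpDomain S ∧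
        ∀ v ∈ Φ.source, Φ v = (v.proj, sprayExp S v) := by
  have : T2Space (TangentBundle 𝓘(ℝ, E) M) := t2Space_tangentBundle
  set T := (tangentChart x : PartialEquiv (TangentBundle 𝓘(ℝ, E) M) (E × E)).target with hT_def
  have hT : IsOpen T := isOpen_tangentChart_target x
  set y := extChartAt 𝓘(ℝ, E) x x with hy
  have hzs : (⟨x, 0⟩ : TangentBundle 𝓘(ℝ, E) M) ∈ (tangentChart x).source :=
    mem_tangentChart_source.2 (mem_chart_source E x)
  have hyT : (y, (0 : E)) ∈ T := by
    have := (tangentChart x).map_source hzs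
    rwa [tangentChart_zero] at this
  set g : E × E → E := fun p ↦ (chartField S x p).2 with hg_def
  have hF := hS.contDiffOn_chartField x
  have hg : ContDiffOn ℝ ∞ g T := contDiff_snd.comp_contDiffOn hF
  have hq : ∀ z ∈ (chartAt E x).target, ∀ (c : ℝ) (v : E), g (z, c • v) = c ^ 2 • g (z, v) :=
    fun z hz c v ↦ hS.chartField_smul (p := (z, v)) (mem_tangentChart_target.2 hz) c
  have hyV := mem_tangentChart_target.1 hyT
  have hg0 : g (y, 0) = 0 := by simpa using hq y hyV 0 0
  have hg' : HasFDerivAt g (0 : E × E →L[ℝ] E) (y, 0) :=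
    hasFDerivAt_zero_of_quadratic (chartAt E x).open_target hyV
      ((hg.contDiffAt (hT.mem_nhds hyT)).differentiableAt (by simp)) hq
  obtain ⟨W, α, hW, hyW, hα0, hα, hαs, hαd⟩ :=
    exists_smooth_second_order_flow hT hg hyT hg0 hg'
  have hcurve : ∀ w ∈ (tangentChart x).source, tangentChart x w ∈ W →
      IsFlowCurve S w 1 (fun t ↦ (tangentChart x).symm (α (tangentChart x w) t)) := by
    intro w hw hwW
    refine ⟨?_, -1, 2, by norm_num, by norm_num, fun t ht ↦ ?_⟩
    · simp only [hα0 _ hwW, (tangentChart x).left_inv hw]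
    · obtain ⟨hmem, hder⟩ := hα _ hwW t ht
      refine (hasMFDerivAt_tangentChart_symm_comp hmem ?_).hasMFDerivWithinAt
      have : chartField S x (α (tangentChart x w) t) =
          ((α (tangentChart x w) t).2, g (α (tangentChart x w) t)) :=
        Prod.ext (hS.chartField_fst hmem) rfl
      rwa [this]
  have hexp : ∀ w ∈ (tangentChart x).source, tangentChart x w ∈ W →
      sprayExp S w = (extChartAt 𝓘(ℝ, E) x).symm (α (tangentChart x w) 1).1 := by
    intro w hw hwW
    rw [sprayExp, flow_eq (hS.smooth.of_le (by simp)) (hcurve w hw hwW)]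
    exact tangentChart_symm_proj (hα _ hwW 1 (by norm_num)).1
  have hf : ContDiffOn ℝ ∞ (fun p : E × E ↦ (p.1, (α p 1).1)) W :=
    contDiff_fst.contDiffOn.prodMk hαs
  let D : (E × E) ≃L[ℝ] E × E := ContinuousLinearEquiv.equivOfInverse
    ((ContinuousLinearMap.fst ℝ E E).prod (.fst ℝ E E + .snd ℝ E E))
    ((ContinuousLinearMap.fst ℝ E E).prod (.snd ℝ E E - .fst ℝ E E))
    (fun p ↦ by ext <;> simp) (fun p ↦ by ext <;> simp)
  have hfd : HasFDerivAt (fun p : E × E ↦ (p.1, (α p 1).1)) (D : E × E →L[ℝ] E × E) (y, 0) :=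
    hasFDerivAt_fst.prodMk hαd
  obtain ⟨e, hef, hye, heW, hes⟩ := hf.exists_openPartialHomeomorph hW hyW hfd
  obtain ⟨Φ₁, hΦ₁⟩ := exists_partialDiffeomorph_extChartAt 𝓘(ℝ, E).tangent
    (⟨x, 0⟩ : TangentBundle 𝓘(ℝ, E) M)
  change Φ₁.toPartialEquiv = tangentChart x at hΦ₁
  obtain ⟨Φ₂, hΦ₂⟩ := e.exists_partialDiffeomorph (hef ▸ hf.mono heW) hes
  obtain ⟨Φ₃, hΦ₃⟩ := exists_partialDiffeomorph_extChartAt (𝓘(ℝ, E).prod 𝓘(ℝ, E)) (x, x)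
  have hΦ₁' : ⇑Φ₁ = tangentChart x := congrArg PartialEquiv.toFun hΦ₁
  have hΦ₂' : ⇑Φ₂ = fun p : E × E ↦ (p.1, (α p 1).1) :=
    (congrArg PartialEquiv.toFun hΦ₂).trans hef
  have hΦ₃' : ⇑Φ₃.symm = fun p : E × E ↦ ((extChartAt 𝓘(ℝ, E) x).symm p.1,
      (extChartAt 𝓘(ℝ, E) x).symm p.2) := by
    rw [extChartAt_prod] at hΦ₃
    exact congrArg PartialEquiv.invFun hΦ₃
  have hsource₃ : Φ₃.symm.source = (chartAt E x).target ×ˢ (chartAt E x).target := by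
    change Φ₃.target = _
    rw [hΦ₃, extChartAt_prod, PartialEquiv.prod_target]
    simp
  have hcoe : ∀ v, (Φ₁.trans Φ₂) v = Φ₂ (Φ₁ v) := fun _ ↦ rfl
  have hsource : ∀ v, v ∈ ((Φ₁.trans Φ₂).trans Φ₃.symm).source ↔
      (v ∈ (tangentChart x).source ∧ tangentChart x v ∈ e.source) ∧
        ((tangentChart x v).1, (α (tangentChart x v) 1).1) ∈
          (chartAt E x).target ×ˢ (chartAt E x).target := by
    intro v
    rw [PartialDiffeomorph.mem_trans_source, PartialDiffeomorph.mem_trans_source, hsource₃,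
      hcoe, hΦ₁', hΦ₂', hΦ₁, hΦ₂]
  refine ⟨(Φ₁.trans Φ₂).trans Φ₃.symm, (hsource _).2 ?_, fun v hv ↦ ?_, fun v hv ↦ ?_⟩
  · rw [tangentChart_zero]
    exact ⟨⟨hzs, hye⟩, hyV, mem_tangentChart_target.1 (hα _ hyW 1 (by norm_num)).1⟩
  · obtain ⟨⟨h1, h2⟩, -⟩ := (hsource v).1 hv
    exact ⟨_, hcurve v h1 (heW h2)⟩
  · obtain ⟨⟨h1, h2⟩, -⟩ := (hsource v).1 hv
    have hcoe' : ((Φ₁.trans Φ₂).trans Φ₃.symm) v = Φ₃.symm (Φ₂ (Φ₁ v)) := rfl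
    rw [hexp v h1 (heW h2), hcoe', hΦ₁', hΦ₂', hΦ₃']
    refine Prod.ext ?_ rfl
    have h3 := tangentChart_symm_proj ((tangentChart x).map_source h1)
    rw [(tangentChart x).left_inv h1] at h3
    exact h3.symm

end LocalExponential

/-- A family of open neighbourhoods of the points of a section, such as the zero section of a vector
bundle, contains an open neighbourhood of the section whose intersection with each fibre lies in a
single member of the family. -/
theorem exists_isOpen_fibrewise_subordinate {X Y : Type*} [TopologicalSpace X] [TopologicalSpace Y]
    [ParacompactSpace X] [T2Space X] {π : Y → X} {z : X → Y} (hπ : Continuous π) (hz : Continuous z)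
    (hπz : ∀ x, π (z x) = x) {V : X → Set Y} (hV : ∀ x, IsOpen (V x)) (hzV : ∀ x, z x ∈ V x) :
    ∃ U : Set Y, IsOpen U ∧ (∀ x, z x ∈ U) ∧ ∀ x, ∃ y, ∀ v ∈ U, π v = x → v ∈ V y := by
  obtain ⟨B, hB, hBcov, hBfin, hBsub⟩ := precise_refinement (fun y ↦ z ⁻¹' V y)
    (fun y ↦ (hV y).preimage hz) (eq_univ_of_forall fun x ↦ mem_iUnion.2 ⟨x, hzV x⟩)
  obtain ⟨C, hCcov, hC, hCB⟩ := exists_iUnion_eq_closed_subset hB hBfin.point_finite hBcov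
  refine ⟨{v | ∀ y, π v ∈ C y → v ∈ V y}, ?_, fun x y hxy ↦ ?_, fun x ↦ ?_⟩
  · have h : IsClosed (⋃ y, π ⁻¹' C y ∩ (V y)ᶜ) := by
      refine LocallyFinite.isClosed_iUnion ?_
        fun y ↦ ((hC y).preimage hπ).inter (hV y).isClosed_compl
      exact ((hBfin.subset hCB).preimage_continuous hπ).subset fun y ↦ inter_subset_left
    convert h.isOpen_compl using 1
    ext v
    simp
  · rw [hπz] at hxy
    exact hBsub y (hCB y hxy)
  · obtain ⟨y, hy⟩ := mem_iUnion.1 (hCcov ▸ mem_univ x)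
    exact ⟨y, fun v hv hvx ↦ hv y (hvx ▸ hy)⟩

/-- An injective map which is a local diffeomorphism on an open set is a diffeomorphism of this set
onto its image. -/
theorem exists_partialDiffeomorph_of_injOn {E F H G M N : Type*} [NormedAddCommGroup E]
    [NormedSpace ℝ E] [NormedAddCommGroup F] [NormedSpace ℝ F] [TopologicalSpace H]
    [TopologicalSpace G] {I : ModelWithCorners ℝ E H} {J : ModelWithCorners ℝ F G}
    [TopologicalSpace M] [ChartedSpace H M] [TopologicalSpace N] [ChartedSpace G N] [Nonempty M]
    {n : WithTop ℕ∞} {f : M → N} {U : Set M} (hU : IsOpen U) (hinj : InjOn f U)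
    (hf : ∀ v ∈ U, IsLocalDiffeomorphAt I J n f v) :
    ∃ Φ : PartialDiffeomorph I J M N n, Φ.source = U ∧ ∀ v ∈ U, Φ v = f v := by
  have hnhds : ∀ v ∈ U, ∃ Ψ : PartialDiffeomorph I J M N n, v ∈ Ψ.source ∧ EqOn f Ψ Ψ.source ∧
      ∃ O, IsOpen O ∧ f v ∈ O ∧ O ⊆ f '' U ∧ EqOn (Function.invFunOn f U) Ψ.symm O ∧
        O ⊆ Ψ.target := by
    intro v hv
    obtain ⟨Ψ, hvΨ, hΨ⟩ := hf v hv
    have hO := Ψ.toOpenPartialHomeomorph.isOpen_image_of_subset_source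
      (Ψ.open_source.inter hU) inter_subset_left
    have him : ∀ y ∈ Ψ '' (Ψ.source ∩ U), y ∈ f '' U ∧ Function.invFunOn f U y = Ψ.symm y ∧
        y ∈ Ψ.target := by
      rintro _ ⟨w, ⟨hw, hwU⟩, rfl⟩
      refine ⟨⟨w, hwU, hΨ hw⟩, ?_, Ψ.map_source hw⟩
      have h1 : Ψ.symm (Ψ w) = w := Ψ.left_inv hw
      rw [h1, ← hΨ hw]
      exact hinj.leftInvOn_invFunOn hwU
    exact ⟨Ψ, hvΨ, hΨ, _, hO, ⟨v, ⟨hvΨ, hv⟩, (hΨ hvΨ).symm⟩, fun y hy ↦ (him y hy).1,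
      fun y hy ↦ (him y hy).2.1, fun y hy ↦ (him y hy).2.2⟩
  refine ⟨{ toPartialEquiv := (hinj.bijOn_image).toPartialEquiv
            open_source := hU
            open_target := ?_
            contMDiffOn_toFun := ?_
            contMDiffOn_invFun := ?_ }, rfl, fun _ _ ↦ rfl⟩
  · refine isOpen_iff_mem_nhds.2 ?_
    rintro _ ⟨v, hv, rfl⟩
    obtain ⟨Ψ, -, -, O, hO, hvO, hOU, -⟩ := hnhds v hv
    exact Filter.mem_of_superset (hO.mem_nhds hvO) hOU
  · intro v hv
    obtain ⟨Ψ, hvΨ, hΨ⟩ := hf v hv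
    exact ((Ψ.contMDiffOn.contMDiffAt (Ψ.open_source.mem_nhds hvΨ)).congr_of_eventuallyEq
      (Filter.eventuallyEq_of_mem (Ψ.open_source.mem_nhds hvΨ) hΨ)).contMDiffWithinAt
  · rintro _ ⟨v, hv, rfl⟩
    obtain ⟨Ψ, -, -, O, hO, hvO, -, hOeq, hOt⟩ := hnhds v hv
    exact ((Ψ.symm.contMDiffOn.contMDiffAt (Ψ.open_target.mem_nhds
      (hOt hvO))).congr_of_eventuallyEq
        (Filter.eventuallyEq_of_mem (hO.mem_nhds hvO) hOeq)).contMDiffWithinAt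

theorem fibreScale_zero_zero {E : Type*} [NormedAddCommGroup E] [NormedSpace ℝ E]
    {M : Type*} [TopologicalSpace M] [ChartedSpace E M] [IsManifold 𝓘(ℝ, E) ∞ M] (x : M) (c : ℝ) :
    fibreScale 𝓘(ℝ, E) c (⟨x, 0⟩ : TangentBundle 𝓘(ℝ, E) M) = ⟨x, 0⟩ := by
  rw [fibreScale, smul_zero]

section Spray

variable {E : Type u} [NormedAddCommGroup E] [NormedSpace ℝ E]
  {M : Type*} [TopologicalSpace M] [ChartedSpace E M] [IsManifold 𝓘(ℝ, E) ∞ M]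
  {S : (v : TangentBundle 𝓘(ℝ, E) M) → TangentSpace 𝓘(ℝ, E).tangent v}

theorem IsSpray.apply_zero (hS : IsSpray 𝓘(ℝ, E) S) (x : M) : S ⟨x, 0⟩ = 0 := by
  have h := hS.homogeneous 0 ⟨x, 0⟩
  rw [zero_smul, map_zero, fibreScale_zero_zero] at h
  exact h

theorem IsSpray.sprayExp_zero [T2Space M] (hS : IsSpray 𝓘(ℝ, E) S) (x : M) :
    sprayExp S ⟨x, 0⟩ = x := by
  have : T2Space (TangentBundle 𝓘(ℝ, E) M) := t2Space_tangentBundle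
  have h : IsFlowCurve S ⟨x, 0⟩ 1 (fun _ ↦ ⟨x, 0⟩) := by
    refine ⟨rfl, -1, 2, by norm_num, by norm_num, fun t _ ↦ ?_⟩
    rw [hS.apply_zero]
    refine ((hasMFDerivAt_const (I := 𝓘(ℝ, ℝ)) (I' := 𝓘(ℝ, E).tangent)
      (⟨x, 0⟩ : TangentBundle 𝓘(ℝ, E) M) t).congr_mfderiv ?_).hasMFDerivWithinAt
    exact (ContinuousLinearMap.smulRight_zero _).symm
  rw [sprayExp, flow_eq (hS.smooth.of_le (by simp)) h]

theorem IsSpray.exists_isLocalAddition [CompleteSpace E] [T2Space M] [ParacompactSpace M]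
    (hS : IsSpray 𝓘(ℝ, E) S) :
    ∃ U : Set (TangentBundle 𝓘(ℝ, E) M),
      U ⊆ sprayExpDomain S ∧ IsLocalAddition 𝓘(ℝ, E) U (sprayExp S) := by
  rcases isEmpty_or_nonempty M with hM | hM
  · have : IsEmpty (TangentBundle 𝓘(ℝ, E) M) := ⟨fun v ↦ hM.false v.proj⟩
    exact ⟨∅, empty_subset _, isOpen_empty, isEmptyElim, isEmptyElim,
      { toFun := isEmptyElim
        invFun := isEmptyElim
        source := ∅
        target := ∅
        map_source' := isEmptyElim
        map_target' := isEmptyElim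
        left_inv' := isEmptyElim
        right_inv' := isEmptyElim
        open_source := isOpen_empty
        open_target := isOpen_empty
        contMDiffOn_toFun := isEmptyElim
        contMDiffOn_invFun := isEmptyElim }, rfl, isEmptyElim⟩
  choose Φ h0 hdom hΦ using hS.exists_partialDiffeomorph
  obtain ⟨U, hU, hzU, hfib⟩ := exists_isOpen_fibrewise_subordinate
    (π := fun v : TangentBundle 𝓘(ℝ, E) M ↦ v.proj) (z := fun x ↦ ⟨x, 0⟩)
    (Bundle.contMDiff_proj (IB := 𝓘(ℝ, E)) (TangentSpace 𝓘(ℝ, E)) (n := ∞)).continuous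
    (Bundle.contMDiff_zeroSection ℝ (IB := 𝓘(ℝ, E)) (TangentSpace 𝓘(ℝ, E)) (n := ∞)).continuous
    (fun _ ↦ rfl) (fun x ↦ (Φ x).open_source) h0
  have hmem : ∀ v ∈ U, ∃ y, v ∈ (Φ y).source := fun v hv ↦
    (hfib v.proj).imp fun y h ↦ h v hv rfl
  have : Nonempty (TangentBundle 𝓘(ℝ, E) M) := hM.map fun x ↦ ⟨x, 0⟩
  refine ⟨U, fun v hv ↦ ?_, hU, hzU, hS.sprayExp_zero, ?_⟩
  · obtain ⟨y, hy⟩ := hmem v hv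
    exact hdom y hy
  · refine exists_partialDiffeomorph_of_injOn (I := 𝓘(ℝ, E).tangent)
      (J := 𝓘(ℝ, E).prod 𝓘(ℝ, E)) (f := fun v ↦ (v.proj, sprayExp S v)) hU ?_ ?_
    · intro v hv w hw hvw
      obtain ⟨y, hy⟩ := hfib v.proj
      have hvy := hy v hv rfl
      have hwy := hy w hw (congrArg Prod.fst hvw).symm
      refine (Φ y).injOn hvy hwy ?_
      rw [hΦ y v hvy, hΦ y w hwy]
      exact hvw
    · intro v hv
      obtain ⟨y, hy⟩ := hmem v hv
      exact ⟨Φ y, hy, fun w hw ↦ (hΦ y w hw).symm⟩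

end Spray

section SprayExistence

variable {E : Type*} [NormedAddCommGroup E] [NormedSpace ℝ E]
  {M : Type*} [TopologicalSpace M] [ChartedSpace E M] [IsManifold 𝓘(ℝ, E) ∞ M]

/-- The vector field on the tangent bundle which, in the chart `tangentChart x`, is the spray
`(y, v) ↦ (v, 0)`. -/
noncomputable def chartSpray (x : M) (w : TangentBundle 𝓘(ℝ, E) M) :
    TangentSpace 𝓘(ℝ, E).tangent w :=
  (trivializationAt (E × E)
    (TangentSpace 𝓘(ℝ, E).tangent : TangentBundle 𝓘(ℝ, E) M → Type _) ⟨x, 0⟩).symm w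
      ((tangentChart x w).2, 0)

theorem mem_baseSet_of_mem_tangentChart_source {x : M} {w : TangentBundle 𝓘(ℝ, E) M}
    (hw : w ∈ (tangentChart x).source) : w ∈ (trivializationAt (E × E)
      (TangentSpace 𝓘(ℝ, E).tangent : TangentBundle 𝓘(ℝ, E) M → Type _) ⟨x, 0⟩).baseSet := by
  rw [tangentChart, extChartAt_source] at hw
  exact hw

theorem trivializationAt_chartSpray {x : M} {w : TangentBundle 𝓘(ℝ, E) M}
    (hw : w ∈ (tangentChart x).source) :
    (trivializationAt (E × E)
      (TangentSpace 𝓘(ℝ, E).tangent : TangentBundle 𝓘(ℝ, E) M → Type _) ⟨x, 0⟩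
        ⟨w, chartSpray x w⟩).2 = ((tangentChart x w).2, 0) := by
  rw [chartSpray, Bundle.Trivialization.apply_mk_symm _ (mem_baseSet_of_mem_tangentChart_source hw)]

theorem tangentChartDeriv_chartSpray {x : M} {w : TangentBundle 𝓘(ℝ, E) M}
    (hw : w ∈ (tangentChart x).source) :
    tangentChartDeriv x w (chartSpray x w) = ((tangentChart x w).2, 0) := by
  rw [← trivializationAt_snd_eq_tangentChartDeriv hw, trivializationAt_chartSpray hw]

theorem contMDiffOn_chartSpray (x : M) :
    ContMDiffOn 𝓘(ℝ, E).tangent 𝓘(ℝ, E).tangent.tangent ∞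
      (fun w ↦ (⟨w, chartSpray x w⟩ :
        TangentBundle 𝓘(ℝ, E).tangent (TangentBundle 𝓘(ℝ, E) M)))
      (tangentChart x : PartialEquiv (TangentBundle 𝓘(ℝ, E) M) (E × E)).source := by
  refine ((trivializationAt (E × E)
    (TangentSpace 𝓘(ℝ, E).tangent : TangentBundle 𝓘(ℝ, E) M → Type _)
      ⟨x, 0⟩).contMDiffOn_section_iff (isOpen_tangentChart_source x)
        fun _ hw ↦ mem_baseSet_of_mem_tangentChart_source hw).2 ?_
  have h0 : ContDiff ℝ ∞ (fun p : E × E ↦ (p.2, (0 : E))) := contDiff_snd.prodMk contDiff_const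
  exact (h0.contMDiff.comp_contMDiffOn (contMDiffOn_tangentChart x)).congr
    fun w hw ↦ trivializationAt_chartSpray hw

theorem mfderiv_proj_chartSpray {x : M} {w : TangentBundle 𝓘(ℝ, E) M}
    (hw : w ∈ (tangentChart x).source) :
    mfderiv 𝓘(ℝ, E).tangent 𝓘(ℝ, E) (fun v : TangentBundle 𝓘(ℝ, E) M ↦ v.proj) w
      (chartSpray x w) = w.snd := by
  have h := fst_tangentChartDeriv hw (chartSpray x w)
  rw [tangentChartDeriv_chartSpray hw, tangentChart_apply hw] at h
  refine (isInvertible_mfderiv_extChartAt (I := 𝓘(ℝ, E)) (x := x) ?_).injective h.symm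
  rw [extChartAt_source]
  exact mem_tangentChart_source.1 hw

theorem chartSpray_fibreScale {x : M} {w : TangentBundle 𝓘(ℝ, E) M}
    (hw : w ∈ (tangentChart x).source) (c : ℝ) :
    chartSpray x (fibreScale 𝓘(ℝ, E) c w) =
      mfderiv 𝓘(ℝ, E).tangent 𝓘(ℝ, E).tangent (fibreScale 𝓘(ℝ, E) c) w
        (c • chartSpray x w) := by
  obtain ⟨h1, h2⟩ := tangentChart_fibreScale hw c
  apply tangentChartDeriv_injective h1
  rw [tangentChartDeriv_chartSpray h1, tangentChartDeriv_fibreScale hw, map_smul,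
    tangentChartDeriv_chartSpray hw, h2]
  simp

theorem IsSmoothlyParacompact.exists_isSpray (hM : IsSmoothlyParacompact 𝓘(ℝ, E) M) :
    ∃ S : (v : TangentBundle 𝓘(ℝ, E) M) → TangentSpace 𝓘(ℝ, E).tangent v,
      IsSpray 𝓘(ℝ, E) S := by
  obtain ⟨ρ, hρ⟩ := hM.exists_partition M (fun x ↦ (chartAt E x).source)
    (fun x ↦ (chartAt E x).open_source)
    (eq_univ_of_forall fun x ↦ mem_iUnion.2 ⟨x, mem_chart_source E x⟩)
  have hπ : ContMDiff 𝓘(ℝ, E).tangent 𝓘(ℝ, E) ∞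
      (fun v : TangentBundle 𝓘(ℝ, E) M ↦ v.proj) :=
    Bundle.contMDiff_proj (IB := 𝓘(ℝ, E)) (TangentSpace 𝓘(ℝ, E))
  have hmem : ∀ (i : M) (w : TangentBundle 𝓘(ℝ, E) M), ρ i w.proj ≠ 0 →
      w ∈ (tangentChart i).source := fun i w h ↦
    mem_tangentChart_source.2 (hρ i (subset_tsupport _ h))
  have hfin : ∀ w : TangentBundle 𝓘(ℝ, E) M,
      (Function.support fun i ↦ ρ i w.proj • chartSpray i w).Finite := fun w ↦
    (ρ.locallyFinite.point_finite w.proj).subset fun i hi h ↦ hi (by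
      have h' : ρ i w.proj = 0 := h
      simp only [h']
      exact zero_smul ℝ _)
  refine ⟨fun w ↦ ∑ᶠ i, ρ i w.proj • chartSpray i w, ?_, fun w ↦ ?_, fun c w ↦ ?_⟩
  · refine ContMDiff.finsum_section_of_locallyFinite
      (t := fun i (w : TangentBundle 𝓘(ℝ, E) M) ↦ ρ i w.proj • chartSpray i w) ?_ fun i ↦ ?_
    · refine (ρ.locallyFinite.preimage_continuous hπ.continuous).subset fun i w hw h ↦ hw ?_
      have h' : ρ i w.proj = 0 := h
      rw [h']
      exact zero_smul ℝ _
    · refine ContMDiffOn.smul_section_of_tsupport (ψ := fun w ↦ ρ i w.proj)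
        ((ρ i).contMDiff.comp hπ).contMDiffOn (isOpen_tangentChart_source i) ?_
        (contMDiffOn_chartSpray i)
      refine (tsupport_comp_subset_preimage (ρ i) hπ.continuous).trans fun w hw ↦ ?_
      exact mem_tangentChart_source.2 (hρ i hw)
  · rw [map_finsum _ (hfin w)]
    have h : ∀ i, mfderiv 𝓘(ℝ, E).tangent 𝓘(ℝ, E) (fun v : TangentBundle 𝓘(ℝ, E) M ↦ v.proj) w
        (ρ i w.proj • chartSpray i w) = ρ i w.proj • w.snd := by
      intro i
      rw [map_smul]
      by_cases hi : ρ i w.proj = 0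
      · rw [hi, zero_smul, zero_smul]
      · rw [mfderiv_proj_chartSpray (hmem i w hi)]
    rw [finsum_congr h, ← finsum_smul, ρ.sum_eq_one (mem_univ _)]
    exact one_smul _ _
  · rw [map_smul, map_finsum _ (hfin w), smul_finsum]
    refine finsum_congr fun i ↦ ?_
    change ρ i w.proj • chartSpray i (fibreScale 𝓘(ℝ, E) c w) = _
    by_cases hi : ρ i w.proj = 0
    · rw [hi]
      simp
    · rw [chartSpray_fibreScale (hmem i w hi), map_smul, map_smul]
      exact smul_comm _ _ _

end SprayExistence

theorem mainTheorem6 {E : Type*} [NormedAddCommGroup E] [NormedSpace ℝ E] [CompleteSpace E]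
    {M : Type*} [TopologicalSpace M] [T2Space M] [ChartedSpace E M] [IsManifold 𝓘(ℝ, E) ∞ M]
    (hM : IsSmoothlyParacompact 𝓘(ℝ, E) M) :
    (∃ (U : Set (TangentBundle 𝓘(ℝ, E) M)) (σ : TangentBundle 𝓘(ℝ, E) M → M),
      IsLocalAddition 𝓘(ℝ, E) U σ) ∧
    (∃ S : (v : TangentBundle 𝓘(ℝ, E) M) → TangentSpace 𝓘(ℝ, E).tangent v,
      IsSpray 𝓘(ℝ, E) S) ∧
    (∀ S : (v : TangentBundle 𝓘(ℝ, E) M) → TangentSpace 𝓘(ℝ, E).tangent v,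
      IsSpray 𝓘(ℝ, E) S →
        ∃ U : Set (TangentBundle 𝓘(ℝ, E) M),
          U ⊆ sprayExpDomain S ∧ IsLocalAddition 𝓘(ℝ, E) U (sprayExp S)) := by
  have : ParacompactSpace M := hM.paracompact
  obtain ⟨S, hS⟩ := hM.exists_isSpray
  obtain ⟨U, -, hU⟩ := hS.exists_isLocalAddition
  exact ⟨⟨U, _, hU⟩, ⟨S, hS⟩, fun S hS ↦ hS.exists_isLocalAddition⟩
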